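/- Let $k$ be a commutative domain and let $K$ be an abstract simplicial complex on the vertices $x_1,\ldots,x_n$ (the empty set being counted as a face of $K$). Let $R=R_K=k[x_1,\ldots,x_n]/I_K$ be its Stanley-Reisner ring, where $I_K$ is the ideal generated by the square-free monomials $x_{i_1}\cdots x_{i_r}$ with $\{x_{i_1},\ldots,x_{i_r}\}\notin K$. Let $D(R)=\bigcup_{m\ge 0}D^m(R)\subseteq \mathrm{End}_k(R)$ be the ring of $k$-linear differential operators on $R$, where $D^0(R)=R$ (acting by multiplication) and $D^m(R)=\{\phi\in \mathrm{End}_k(R) : [\phi,r]\in D^{m-1}(R)\text{ for all } r\in R\}$ for $m>0$. For a face $\sigma\in K$ put $x_\sigma=\prod_{x_i\in\sigma}x_i\in R$, let $\langle x_\sigma\rangle$ be the two-sided ideal of $D(R)$ generated by $x_\sigma$, and let $\mathrm{st}(\sigma)=\{\alpha\in K : \alpha\cup\sigma\in K\}$ be the closed star of $\sigma$ in $K$. Then for all faces $\sigma,\tau\in K$, $$\langle x_\tau\rangle\subseteq\langle x_\sigma\rangle \iff \mathrm{st}(\tau)\subseteq \mathrm{st}(\sigma).$$ -/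

import Mathlib

/-! ### Differential operators -/

section DiffOps

/-- The commutator `[φ, r] = φ ∘ r - r ∘ φ` of an endomorphism `φ` of `R` with multiplication by
`r`, as a `k`-linear map in `φ`. -/
def commMul (k R : Type*) [CommRing k] [CommRing R] [Algebra k R] (r : R) :
    Module.End k R →ₗ[k] Module.End k R where
  toFun φ := φ * Algebra.lmul k R r - Algebra.lmul k R r * φ
  map_add' φ ψ := by rw [add_mul, mul_add]; abel
  map_smul' c φ := by
    rw [smul_mul_assoc, mul_smul_comm, smul_sub, RingHom.id_apply]

/-- The `k`-linear differential operators of order at most `n` on a commutative `k`-algebra `R`: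
order `0` are the multiplication operators, and `φ` has order at most `n + 1` if the commutator
of `φ` with multiplication by any `r : R` has order at most `n`. -/
def diffOpLE (k R : Type*) [CommRing k] [CommRing R] [Algebra k R] :
    ℕ → Submodule k (Module.End k R)
  | 0 => LinearMap.range (Algebra.lmul k R).toLinearMap
  | n + 1 =>
    { carrier := {φ | ∀ r : R, commMul k R r φ ∈ diffOpLE k R n}
      add_mem' := fun {φ ψ} hφ hψ r => by
        rw [map_add]; exact add_mem (hφ r) (hψ r)
      zero_mem' := fun r => by rw [map_zero]; exact zero_mem _
      smul_mem' := fun c φ hφ r => by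
        rw [map_smul]; exact Submodule.smul_mem _ c (hφ r) }

variable {k R : Type*} [CommRing k] [CommRing R] [Algebra k R]

theorem commMul_apply (r : R) (φ : Module.End k R) :
    commMul k R r φ = φ * Algebra.lmul k R r - Algebra.lmul k R r * φ := rfl

theorem lmul_mem_diffOpLE_zero (r : R) : Algebra.lmul k R r ∈ diffOpLE k R 0 := ⟨r, rfl⟩

theorem mem_diffOpLE_succ {n : ℕ} {φ : Module.End k R} :
    φ ∈ diffOpLE k R (n + 1) ↔ ∀ r : R, commMul k R r φ ∈ diffOpLE k R n := Iff.rfl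

theorem commMul_eq_zero {φ : Module.End k R} (h : φ ∈ diffOpLE k R 0) (r : R) :
    commMul k R r φ = 0 := by
  obtain ⟨s, rfl⟩ := h
  rw [commMul_apply, AlgHom.toLinearMap_apply, ← map_mul, ← map_mul, mul_comm, sub_self]

theorem diffOpLE_le_succ (n : ℕ) : diffOpLE k R n ≤ diffOpLE k R (n + 1) := by
  induction n with
  | zero =>
    intro φ hφ r
    rw [commMul_eq_zero hφ]
    exact zero_mem _
  | succ n ih => exact fun φ hφ r => ih (hφ r)

theorem diffOpLE_mono : Monotone (diffOpLE k R) := monotone_nat_of_le_succ diffOpLE_le_succ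

theorem commMul_mul (φ ψ : Module.End k R) (r : R) :
    commMul k R r (φ * ψ) = φ * commMul k R r ψ + commMul k R r φ * ψ := by
  simp only [commMul_apply, mul_sub, sub_mul, mul_assoc]
  abel

theorem mul_mem_diffOpLE (N : ℕ) : ∀ (m n : ℕ), m + n = N → ∀ {φ ψ : Module.End k R},
    φ ∈ diffOpLE k R m → ψ ∈ diffOpLE k R n → φ * ψ ∈ diffOpLE k R N := by
  induction N with
  | zero =>
    intro m n h φ ψ hφ hψ
    obtain ⟨rfl, rfl⟩ : m = 0 ∧ n = 0 := by omega
    obtain ⟨a, rfl⟩ := hφ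
    obtain ⟨b, rfl⟩ := hψ
    exact ⟨a * b, map_mul (Algebra.lmul k R) a b⟩
  | succ N ih =>
    intro m n h φ ψ hφ hψ r
    rw [commMul_mul]
    refine add_mem ?_ ?_
    · cases n with
      | zero => rw [commMul_eq_zero hψ, mul_zero]; exact zero_mem _
      | succ n => exact ih m n (by omega) hφ (hψ r)
    · cases m with
      | zero => rw [commMul_eq_zero hφ, zero_mul]; exact zero_mem _
      | succ m => exact ih m n (by omega) (hφ r) hψ

variable (k R)

/-- The ring `D_k(R) = ⋃ n, D_k^n(R)` of `k`-linear differential operators on `R`. -/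
def diffOps : Subalgebra k (Module.End k R) where
  carrier := ⋃ n, (diffOpLE k R n : Set (Module.End k R))
  mul_mem' {φ ψ} hφ hψ := by
    obtain ⟨m, hm⟩ := Set.mem_iUnion.1 hφ
    obtain ⟨n, hn⟩ := Set.mem_iUnion.1 hψ
    exact Set.mem_iUnion.2 ⟨m + n, mul_mem_diffOpLE (m + n) m n rfl hm hn⟩
  add_mem' {φ ψ} hφ hψ := by
    obtain ⟨m, hm⟩ := Set.mem_iUnion.1 hφ
    obtain ⟨n, hn⟩ := Set.mem_iUnion.1 hψ
    exact Set.mem_iUnion.2 ⟨max m n, add_mem (diffOpLE_mono (le_max_left m n) hm)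
      (diffOpLE_mono (le_max_right m n) hn)⟩
  algebraMap_mem' c := Set.mem_iUnion.2
    ⟨0, ⟨algebraMap k R c, by rw [AlgHom.toLinearMap_apply, AlgHom.commutes]⟩⟩

/-- The inclusion `R = D_k^0(R) → D_k(R)`, sending `r` to multiplication by `r`. -/
def diffOpsOfRing : R →ₐ[k] diffOps k R :=
  (Algebra.lmul k R).codRestrict (diffOps k R)
    fun r => Set.mem_iUnion.2 ⟨0, lmul_mem_diffOpLE_zero r⟩

end DiffOps

/-! ### Simplicial complexes and face rings -/

section FaceRing

/-- All faces of the abstract simplicial complex `K`, the empty face included (Mathlib's `K.faces`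
lists only the nonempty ones). -/
def simplices {V : Type*} (K : PreAbstractSimplicialComplex V) : Set (Finset V) :=
  insert ∅ K.faces

/-- The closed star `st(σ, K) = {τ ∈ K | τ ∪ σ ∈ K}`. -/
def closedStar {V : Type*} [DecidableEq V] (K : PreAbstractSimplicialComplex V) (σ : Finset V) :
    Set (Finset V) :=
  {τ | τ ∈ simplices K ∧ τ ∪ σ ∈ simplices K}

variable (k : Type*) [CommRing k] {V : Type*}

/-- The face ideal `I_K` of `k[x_v | v ∈ V]`, generated by the square-free monomials
`∏ v ∈ s, x_v` of the non-faces `s` of `K`. -/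
noncomputable def faceIdeal (K : PreAbstractSimplicialComplex V) : Ideal (MvPolynomial V k) :=
  Ideal.span {f | ∃ s : Finset V, s ∉ simplices K ∧ f = ∏ v ∈ s, MvPolynomial.X v}

/-- The Stanley-Reisner ring (face ring) `R_K = k[x_v | v ∈ V] / I_K`. -/
abbrev FaceRing (K : PreAbstractSimplicialComplex V) : Type _ :=
  MvPolynomial V k ⧸ faceIdeal k K

/-- The element `x_σ = ∏ v ∈ σ, x_v` of the face ring. -/
noncomputable def faceMonomial (K : PreAbstractSimplicialComplex V) (σ : Finset V) :
    FaceRing k K :=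
  Ideal.Quotient.mk (faceIdeal k K) (∏ v ∈ σ, MvPolynomial.X v)

/-- The two-sided ideal `⟨f⟩` of `D_k(R)` generated by an element `f` of `R`. -/
noncomputable def diffOpsIdeal (R : Type*) [CommRing R] [Algebra k R] (f : R) : TwoSidedIdeal (diffOps k R) :=
  TwoSidedIdeal.span {diffOpsOfRing k R f}

end FaceRing

/-! Necessity: the operators whose image is killed by a face monomial `x_s` form a two-sided ideal
(`annihilatedOps`). If `α` lies in `st(τ)` but not in `st(σ)`, take `s = α ∪ τ`: that ideal contains
`x_σ`, as `s ∪ σ` is a non-face, but not `x_τ`, as `s` is a face.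

Sufficiency: with `∂^(b)` the divided power derivatives, `∑_{b ≤ a} (-1)^|b| ∂^(a-b) x^a ∂^(b) = 1`
on the polynomial ring (`sum_hasse_monomial_mul_hasse`). For `x^a = x_σ x_τ`, multiplying by `x_τ`
gives `x_τ = ∑ ± (x_τ ∂^(a-b)) x_σ (x_τ ∂^(b))`. The star inclusion makes each `x_τ ∂^(b)` with `b`
supported in `σ ∪ τ` preserve `I_K` (`mul_hasse_mem_faceIdeal`), so the identity descends to `D(R)`.
-/

/-! ### Hasse derivatives on polynomial rings -/

section Hasse

open MvPolynomial

variable (k : Type*) [CommRing k] {V : Type*}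

/-- The Taylor expansion `f(x) ↦ f(x + t)`, with `x` in the coefficients and `t` the variables. -/
noncomputable def taylorShift : MvPolynomial V k →ₐ[k] MvPolynomial V (MvPolynomial V k) :=
  aeval fun i => C (X i) + X i

/-- The divided power derivative `∂^(b)`: the coefficient of `t ^ b` in `f(x + t)`. -/
noncomputable def hasse (b : V →₀ ℕ) : Module.End k (MvPolynomial V k) :=
  (lcoeff (MvPolynomial V k) b).restrictScalars k ∘ₗ (taylorShift k).toLinearMap

variable {k}

theorem hasse_apply (b : V →₀ ℕ) (f : MvPolynomial V k) :
    hasse k b f = coeff b (taylorShift k f) := rfl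

theorem taylorShift_X (i : V) : taylorShift k (X i) = C (X i) + X i := aeval_X _ _

theorem hasse_X_mul [DecidableEq V] (b : V →₀ ℕ) (i : V) (f : MvPolynomial V k) :
    hasse k b (X i * f) =
      X i * hasse k b f + if i ∈ b.support then hasse k (b - Finsupp.single i 1) f else 0 := by
  simp only [hasse_apply, map_mul, taylorShift_X, add_mul, coeff_add, coeff_C_mul]
  rw [mul_comm (X i) (taylorShift k f), coeff_mul_X']

theorem hasse_prod_X_mul (b : V →₀ ℕ) (s : Finset V) (hs : Disjoint s b.support)
    (f : MvPolynomial V k) :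
    hasse k b ((∏ i ∈ s, X i) * f) = (∏ i ∈ s, X i) * hasse k b f := by
  classical
  induction s using Finset.induction_on with
  | empty => simp
  | insert i s hi ih =>
    rw [Finset.disjoint_insert_left] at hs
    rw [Finset.prod_insert hi, mul_assoc, hasse_X_mul, if_neg hs.1, add_zero, ih hs.2, mul_assoc]

theorem monomial_add_single_eq_X_mul (a : V →₀ ℕ) (i : V) :
    monomial (a + Finsupp.single i 1) (1 : k) = X i * monomial a 1 := by
  rw [X, monomial_mul, one_mul, add_comm]

theorem finsupp_nat_induction {p : (V →₀ ℕ) → Prop} (zero : p 0)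
    (add_single : ∀ a i, p a → p (a + Finsupp.single i 1)) (a : V →₀ ℕ) : p a := by
  induction a using Finsupp.induction with
  | zero => exact zero
  | single_add i m f _ _ hf =>
    rw [add_comm]
    clear * - hf add_single
    induction m with
    | zero => simpa using hf
    | succ m ih =>
      rw [Finsupp.single_add, ← add_assoc]
      exact add_single _ _ ih

theorem hasse_monomial_eq_zero (a : V →₀ ℕ) :
    ∀ b : V →₀ ℕ, ¬ b ≤ a → hasse k b (monomial a (1 : k)) = 0 := by
  classical
  induction a using finsupp_nat_induction with
  | zero =>
    intro b hb
    rw [hasse_apply, ← C_apply, C_1, map_one, coeff_one, if_neg]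
    rintro rfl
    exact hb le_rfl
  | add_single a i ih =>
    intro b hb
    rw [monomial_add_single_eq_X_mul, hasse_X_mul,
      ih b fun h => hb (h.trans (le_add_of_nonneg_right zero_le)),
      ih (b - Finsupp.single i 1) fun h => hb (tsub_le_iff_right.1 h)]
    simp

theorem hasse_monomial_self (a : V →₀ ℕ) : hasse k a (monomial a (1 : k)) = 1 := by
  classical
  induction a using finsupp_nat_induction with
  | zero => rw [hasse_apply, ← C_apply, C_1, map_one, coeff_one, if_pos rfl]
  | add_single a i ih =>
    rw [monomial_add_single_eq_X_mul, hasse_X_mul, hasse_monomial_eq_zero, if_pos,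
      add_tsub_cancel_right, ih, mul_zero, zero_add]
    · simp
    · intro h
      simpa using h i

/-- Substituting `x ↦ x + t`, `t ↦ -t` in `f(x + t)` undoes the shift. -/
theorem eval₂_neg_X_taylorShift (f : MvPolynomial V k) :
    eval₂ (taylorShift k).toRingHom (fun i => -X i) (taylorShift k f) = C f := by
  induction f using MvPolynomial.induction_on with
  | C c =>
    simp only [algHom_C, MvPolynomial.algebraMap_apply, algebraMap_eq, eval₂_C,
      AlgHom.toRingHom_eq_coe, RingHom.coe_coe]
  | add p q hp hq => rw [map_add, eval₂_add, hp, hq, map_add]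
  | mul_X p i hp =>
    rw [map_mul, eval₂_mul, hp, taylorShift_X, eval₂_add, eval₂_C, eval₂_X, map_mul]
    simp [taylorShift_X]

/-- Multiply `f(x) = ∑_b (∂^(b) f)(x + t) (-t)^b` by `(x + t)^a` and compare coefficients of `t^a`;
on the left that of `(x + t)^a` is `1`. -/
theorem sum_hasse_monomial_mul_hasse [DecidableEq V] (a : V →₀ ℕ) (f : MvPolynomial V k) :
    ∑ b ∈ Finset.Icc 0 a, (-1 : k) ^ b.degree •
      hasse k (a - b) (monomial a (1 : k) * hasse k b f) = f := by
  have h := congrArg (fun g => coeff a (taylorShift k (monomial a (1 : k)) * g))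
    (eval₂_neg_X_taylorShift f)
  simp only [mul_comm _ (C f), coeff_C_mul, ← hasse_apply, hasse_monomial_self, mul_one] at h
  rw [eval₂_eq, Finset.mul_sum, coeff_sum] at h
  refine Eq.trans ?_ h
  have key : ∀ b : V →₀ ℕ, coeff a (taylorShift k (monomial a (1 : k)) *
      ((taylorShift k).toRingHom (coeff b (taylorShift k f)) *
        ∏ i ∈ b.support, (-X i : MvPolynomial V (MvPolynomial V k)) ^ b i)) =
      if b ≤ a then (-1 : k) ^ b.degree •
        hasse k (a - b) (monomial a (1 : k) * hasse k b f) else 0 := by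
    intro b
    have hb : ∏ i ∈ b.support, (-X i : MvPolynomial V (MvPolynomial V k)) ^ b i =
        monomial b ((-1) ^ b.degree) := by
      rw [monomial_eq, Finsupp.degree_apply, Finsupp.prod]
      simp_rw [neg_pow (X _ : MvPolynomial V (MvPolynomial V k))]
      rw [Finset.prod_mul_distrib, Finset.prod_pow_eq_pow_sum]
      simp
    rw [hb, ← mul_assoc, coeff_mul_monomial', AlgHom.toRingHom_eq_coe, RingHom.coe_coe,
      ← map_mul, ← hasse_apply, ← hasse_apply]
    congr 1
    rw [Algebra.smul_def, mul_comm]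
    simp
  rw [Finset.sum_congr rfl fun b _ => key b, ← Finset.sum_filter]
  symm
  -- The expansion runs only over `b` with `∂^(b) f ≠ 0`; the extra terms of the full interval
  -- vanish.
  apply Finset.sum_subset
  · exact fun b hb => Finset.mem_Icc.2 ⟨zero_le, (Finset.mem_filter.1 hb).2⟩
  · intro b hb hb'
    have : hasse k b f = 0 := by
      by_contra h0
      exact hb' (Finset.mem_filter.2 ⟨mem_support_iff.2 h0, (Finset.mem_Icc.1 hb).2⟩)
    rw [this, mul_zero, map_zero, smul_zero]

end Hasse

/-! ### Differential operators on quotients -/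

section Quotient

open MvPolynomial (coeff coeff_add coeff_C_mul coeff_mul_X' C)

variable {k R : Type*} [CommRing k] [CommRing R] [Algebra k R]

theorem commMul_apply_apply (r : R) (φ : Module.End k R) (f : R) :
    commMul k R r φ f = φ (r * f) - r * φ f := rfl

theorem commMul_mul_right (φ : Module.End k R) (r s : R) :
    commMul k R (r * s) φ = commMul k R r φ * Algebra.lmul k R s +
      Algebra.lmul k R r * commMul k R s φ := by
  simp only [commMul_apply, map_mul, mul_sub, sub_mul, mul_assoc]
  abel

/-- By the Leibniz rule for `r ↦ [φ, r]`, the `r` whose commutator has order at most `m` form a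
subalgebra, so generators suffice. -/
theorem mem_diffOpLE_succ_of_X {V : Type*} {m : ℕ} {φ : Module.End k (MvPolynomial V k)}
    (h : ∀ i, commMul k _ (MvPolynomial.X i) φ ∈ diffOpLE k (MvPolynomial V k) m) :
    φ ∈ diffOpLE k (MvPolynomial V k) (m + 1) := by
  intro r
  induction r using MvPolynomial.induction_on with
  | C c =>
    have : commMul k _ (MvPolynomial.C c) φ = 0 := by
      refine LinearMap.ext fun f => ?_
      rw [commMul_apply_apply, ← MvPolynomial.smul_eq_C_mul, ← MvPolynomial.smul_eq_C_mul,
        map_smul, sub_self, LinearMap.zero_apply]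
    rw [this]; exact zero_mem _
  | add p q hp hq =>
    have : commMul k _ (p + q) φ = commMul k _ p φ + commMul k _ q φ := by
      simp only [commMul_apply, map_add, mul_add, add_mul]; abel
    rw [this]; exact add_mem hp hq
  | mul_X p i hp =>
    rw [commMul_mul_right]
    exact add_mem (mul_mem_diffOpLE m m 0 rfl hp (lmul_mem_diffOpLE_zero _))
      (mul_mem_diffOpLE m 0 m (zero_add m) (lmul_mem_diffOpLE_zero _) (h i))

theorem hasse_mem_diffOpLE {V : Type*} (m : ℕ) :
    ∀ b : V →₀ ℕ, b.degree ≤ m → hasse k b ∈ diffOpLE k (MvPolynomial V k) m := by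
  classical
  -- Commuting with a variable lowers `b` by one unit, which drives the induction on the order.
  have hc : ∀ (b : V →₀ ℕ) (i : V), commMul k _ (MvPolynomial.X i) (hasse k b) =
      if i ∈ b.support then hasse k (b - Finsupp.single i 1) else 0 := by
    intro b i
    refine LinearMap.ext fun f => ?_
    rw [commMul_apply_apply, hasse_X_mul, add_sub_cancel_left]
    split_ifs <;> rfl
  induction m with
  | zero =>
    intro b hb
    rw [Nat.le_zero, Finsupp.degree_eq_zero_iff] at hb
    subst hb
    refine ⟨1, LinearMap.ext fun f => ?_⟩
    change 1 * f = coeff 0 (taylorShift k f)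
    rw [one_mul]
    induction f using MvPolynomial.induction_on with
    | C c =>
      simp [taylorShift, MvPolynomial.algebraMap_eq]
    | add p q hp hq => rw [map_add, coeff_add, ← hp, ← hq]
    | mul_X p i hp =>
      rw [map_mul, taylorShift_X, mul_add, coeff_add, mul_comm _ (C _), coeff_C_mul, ← hp,
        coeff_mul_X', if_neg (by simp), add_zero, mul_comm]
  | succ m ih =>
    intro b hb
    refine mem_diffOpLE_succ_of_X fun i => ?_
    rw [hc]
    split_ifs with hi
    · apply ih
      have h1 := congrArg Finsupp.degree
        (Finsupp.sub_add_single_one_cancel (Finsupp.mem_support_iff.1 hi))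
      rw [map_add, Finsupp.degree_single] at h1
      omega
    · exact zero_mem _

theorem mapQ_mem_diffOpLE (I : Ideal R) (m : ℕ) :
    ∀ (φ : Module.End k R) (ψ : Module.End k (R ⧸ I)), φ ∈ diffOpLE k R m →
      (∀ r, ψ (Ideal.Quotient.mk I r) = Ideal.Quotient.mk I (φ r)) →
      ψ ∈ diffOpLE k (R ⧸ I) m := by
  induction m with
  | zero =>
    rintro φ ψ ⟨s, rfl⟩ h
    refine ⟨Ideal.Quotient.mk I s, ?_⟩
    refine LinearMap.ext fun x => ?_
    obtain ⟨r, rfl⟩ := Ideal.Quotient.mk_surjective x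
    rw [h]
    exact (map_mul (Ideal.Quotient.mk I) s r).symm
  | succ m ih =>
    intro φ ψ hφ h x
    obtain ⟨s, rfl⟩ := Ideal.Quotient.mk_surjective x
    refine ih _ _ (hφ s) fun r => ?_
    rw [commMul_apply_apply, commMul_apply_apply, ← map_mul, h, h, ← map_mul, ← map_sub]

theorem exists_diffOps_of_map_le (I : Ideal R) {m : ℕ} {φ : Module.End k R}
    (hφ : φ ∈ diffOpLE k R m) (hI : ∀ r ∈ I, φ r ∈ I) :
    ∃ ψ : diffOps k (R ⧸ I), ∀ r, (ψ : Module.End k (R ⧸ I)) (Ideal.Quotient.mk I r) =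
      Ideal.Quotient.mk I (φ r) := by
  let ψ : Module.End k (R ⧸ I) :=
    Submodule.mapQ (I.restrictScalars k) (I.restrictScalars k) φ hI
  have h : ∀ r, ψ (Ideal.Quotient.mk I r) = Ideal.Quotient.mk I (φ r) := fun r => rfl
  exact ⟨⟨ψ, Set.mem_iUnion.2 ⟨m, mapQ_mem_diffOpLE I m φ ψ hφ h⟩⟩, h⟩

/-- If `s f = 0` then `[φ, s] f = -s (φ f)`, so each drop in order costs one factor of `s`. -/
theorem pow_mul_apply_eq_zero (s : R) (m : ℕ) : ∀ φ ∈ diffOpLE k R m, ∀ f : R,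
    s * f = 0 → s ^ (m + 1) * φ f = 0 := by
  induction m with
  | zero =>
    rintro _ ⟨r, rfl⟩ f hf
    change s ^ (0 + 1) * (r * f) = 0
    linear_combination r * hf
  | succ m ih =>
    intro φ hφ f hf
    have h := ih _ (hφ s) f hf
    rw [commMul_apply_apply, hf, map_zero, zero_sub] at h
    linear_combination -h

end Quotient

/-! ### Ideals generated by face monomials -/

section Main

open MvPolynomial

variable {k : Type*} [CommRing k] {V : Type*} {K : PreAbstractSimplicialComplex V}

/-! ### Monomials and the face ideal -/

theorem simplices_of_subset {s t : Finset V} (ht : t ∈ simplices K) (h : s ⊆ t) :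
    s ∈ simplices K := by
  rcases s.eq_empty_or_nonempty with rfl | hs
  · exact Set.mem_insert _ _
  · rcases ht with rfl | ht
    · simp_all
    · exact Or.inr ((K.isRelLowerSet_faces ht).2 h hs)

theorem prod_X_mem_faceIdeal {s : Finset V} (hs : s ∉ simplices K) :
    ∏ i ∈ s, X i ∈ faceIdeal k K := Ideal.subset_span ⟨s, hs, rfl⟩

/-- The exponent of the square-free monomial with support `s`. -/
noncomputable def sqfreeExp (s : Finset V) : V →₀ ℕ := ∑ i ∈ s, Finsupp.single i 1

theorem monomial_sqfreeExp (s : Finset V) :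
    monomial (sqfreeExp s) (1 : k) = ∏ i ∈ s, X i := monomial_sum_one _ _

theorem sqfreeExp_apply [DecidableEq V] (s : Finset V) (i : V) :
    sqfreeExp s i = if i ∈ s then 1 else 0 := by
  simp [sqfreeExp, Finsupp.finsetSum_apply, Finsupp.single_apply]

theorem sqfreeExp_le_iff (s : Finset V) (a : V →₀ ℕ) : sqfreeExp s ≤ a ↔ s ⊆ a.support := by
  classical
  constructor
  · intro h i hi
    have := h i
    rw [sqfreeExp_apply, if_pos hi] at this
    rw [Finsupp.mem_support_iff]; omega
  · intro h i
    rw [sqfreeExp_apply]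
    split_ifs with hi
    · have := Finsupp.mem_support_iff.1 (h hi); omega
    · exact Nat.zero_le _

theorem mem_faceIdeal_iff {f : MvPolynomial V k} :
    f ∈ faceIdeal k K ↔ ∀ a ∈ f.support, a.support ∉ simplices K := by
  have : faceIdeal k K =
      Ideal.span ((fun a => monomial a (1 : k)) '' (sqfreeExp '' (simplices K)ᶜ)) := by
    rw [faceIdeal]
    congr 1
    ext f
    simp only [Set.image_image, monomial_sqfreeExp, Set.mem_image, Set.mem_ofPred_eq,
      Set.mem_compl_iff, eq_comm]
  rw [this, mem_ideal_span_monomial_image]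
  refine forall₂_congr fun a _ => ⟨?_, fun h => ⟨_, ⟨_, h, rfl⟩, (sqfreeExp_le_iff _ _).2 le_rfl⟩⟩
  rintro ⟨_, ⟨s, hs, rfl⟩, h⟩ ha
  exact hs (simplices_of_subset ha ((sqfreeExp_le_iff _ _).1 h))

theorem monomial_mul_mem_faceIdeal_iff [DecidableEq V] {c : V →₀ ℕ} {f : MvPolynomial V k} :
    monomial c 1 * f ∈ faceIdeal k K ↔
      ∀ a ∈ f.support, c.support ∪ a.support ∉ simplices K := by
  rw [mem_faceIdeal_iff]
  have hs : ∀ a : V →₀ ℕ, (c + a).support = c.support ∪ a.support := fun a => by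
    ext i; simp [Finsupp.mem_support_iff]; tauto
  constructor
  · intro h a ha
    rw [← hs]
    apply h
    rw [mem_support_iff, coeff_monomial_mul, one_mul]
    exact mem_support_iff.1 ha
  · intro h a ha
    rw [mem_support_iff, coeff_monomial_mul'] at ha
    split_ifs at ha with hc
    · rw [one_mul] at ha
      have := h _ (mem_support_iff.2 ha)
      rwa [← hs, add_tsub_cancel_of_le hc] at this
    · exact absurd rfl ha

/-- Membership in `I_K` depends only on supports of exponents, and a positive power of a monomial
has the same support. -/
theorem faceMonomial_mul_eq_zero_of_pow {s : Finset V} {m : ℕ} {f : FaceRing k K}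
    (h : faceMonomial k K s ^ (m + 1) * f = 0) : faceMonomial k K s * f = 0 := by
  classical
  obtain ⟨f, rfl⟩ := Ideal.Quotient.mk_surjective f
  rw [faceMonomial, ← monomial_sqfreeExp] at *
  rw [← map_pow, ← map_mul, Ideal.Quotient.eq_zero_iff_mem, monomial_pow, one_pow,
    monomial_mul_mem_faceIdeal_iff, Finsupp.support_smul_eq (Nat.succ_ne_zero m)] at h
  rwa [← map_mul, Ideal.Quotient.eq_zero_iff_mem, monomial_mul_mem_faceIdeal_iff]

theorem faceMonomial_mul_eq_zero [DecidableEq V] {s t : Finset V} (h : s ∪ t ∉ simplices K) :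
    faceMonomial k K s * faceMonomial k K t = 0 := by
  rw [faceMonomial, faceMonomial, ← map_mul, Ideal.Quotient.eq_zero_iff_mem,
    ← Finset.prod_union_inter]
  exact Ideal.mul_mem_right _ _ (prod_X_mem_faceIdeal h)

theorem faceMonomial_mul_ne_zero [Nontrivial k] [DecidableEq V] {s t : Finset V}
    (h : s ∪ t ∈ simplices K) : faceMonomial k K s * faceMonomial k K t ≠ 0 := by
  have hs : ∀ s : Finset V, (sqfreeExp s).support = s := fun s => by
    ext i; simp [sqfreeExp_apply]
  rw [faceMonomial, faceMonomial, ← map_mul, Ne, Ideal.Quotient.eq_zero_iff_mem,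
    ← monomial_sqfreeExp, ← monomial_sqfreeExp, monomial_mul_mem_faceIdeal_iff]
  intro h'
  refine h' (sqfreeExp t) ?_ (by rwa [hs, hs])
  simp [mem_support_iff]

/-! ### Necessity of the star inclusion -/

variable (k K) in
/-- The operators in `D(R)` whose image is annihilated by the face monomial `x_s`. -/
noncomputable def annihilatedOps (s : Finset V) : TwoSidedIdeal (diffOps k (FaceRing k K)) :=
  TwoSidedIdeal.mk' {φ | ∀ f, faceMonomial k K s * (φ : Module.End k (FaceRing k K)) f = 0}
    (fun f => by simp)
    (fun {φ ψ} hφ hψ f => by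
      simp only [Subalgebra.coe_add, LinearMap.add_apply, mul_add, hφ f, hψ f, add_zero])
    (fun {φ} hφ f => by
      rw [Subalgebra.coe_neg, LinearMap.neg_apply, mul_neg (faceMonomial k K s), hφ f, neg_zero])
    -- Left absorption is the substantial axiom: an operator of order `m` preserves annihilation up
    -- to the power `x_s^(m+1)`, which is then reduced to `x_s`.
    (fun {φ ψ} hψ f => by
      obtain ⟨m, hm⟩ := Set.mem_iUnion.1 φ.2
      exact faceMonomial_mul_eq_zero_of_pow (pow_mul_apply_eq_zero _ m _ hm _ (hψ f)))
    (fun {φ ψ} hφ f => hφ _)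

theorem mem_annihilatedOps {s : Finset V} {φ : diffOps k (FaceRing k K)} :
    φ ∈ annihilatedOps k K s ↔
      ∀ f, faceMonomial k K s * (φ : Module.End k (FaceRing k K)) f = 0 :=
  TwoSidedIdeal.mem_mk' ..

theorem closedStar_subset_of_diffOpsIdeal_le [Nontrivial k] [DecidableEq V] {σ τ : Finset V}
    (h : diffOpsIdeal k (FaceRing k K) (faceMonomial k K τ) ≤
      diffOpsIdeal k (FaceRing k K) (faceMonomial k K σ)) :
    closedStar K τ ⊆ closedStar K σ := by
  rintro α ⟨hα, hατ⟩
  refine ⟨hα, ?_⟩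
  by_contra hασ
  have hσ : diffOpsIdeal k (FaceRing k K) (faceMonomial k K σ) ≤ annihilatedOps k K (α ∪ τ) := by
    refine TwoSidedIdeal.span_le.2 (Set.singleton_subset_iff.2 (mem_annihilatedOps.2 fun f => ?_))
    have h0 : faceMonomial k K (α ∪ τ) * faceMonomial k K σ = 0 :=
      faceMonomial_mul_eq_zero fun h' => hασ (simplices_of_subset h' (by
        intro i; simp only [Finset.mem_union]; tauto))
    change faceMonomial k K (α ∪ τ) * (faceMonomial k K σ * f) = 0
    rw [← mul_assoc, h0, zero_mul]
  have h1 := mem_annihilatedOps.1 (hσ (h (TwoSidedIdeal.subset_span rfl))) 1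
  change faceMonomial k K (α ∪ τ) * (faceMonomial k K τ * 1) = 0 at h1
  rw [mul_one] at h1
  refine faceMonomial_mul_ne_zero ?_ h1
  rwa [Finset.union_assoc, Finset.union_self]

/-! ### Sufficiency of the star inclusion -/

theorem mul_hasse_mem_faceIdeal [DecidableEq V] {σ τ : Finset V}
    (h : closedStar K τ ⊆ closedStar K σ) {f : MvPolynomial V k} (hf : f ∈ faceIdeal k K) :
    ∀ b : V →₀ ℕ, b.support ⊆ σ ∪ τ → (∏ i ∈ τ, X i) * hasse k b f ∈ faceIdeal k K := by
  rw [faceIdeal] at hf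
  induction hf using Submodule.span_induction with
  | zero => simp
  | add f g _ _ hf hg =>
    intro b hb
    rw [map_add, mul_add]
    exact add_mem (hf b hb) (hg b hb)
  | smul r f _ hf =>
    induction r using MvPolynomial.induction_on with
    | C c =>
      intro b hb
      rw [smul_eq_mul, ← smul_eq_C_mul, map_smul, smul_eq_C_mul, mul_left_comm]
      exact Ideal.mul_mem_left _ _ (hf b hb)
    | add p q hp hq =>
      intro b hb
      rw [add_smul, map_add, mul_add]
      exact add_mem (hp b hb) (hq b hb)
    | mul_X p i hp =>
      intro b hb
      rw [mul_comm p, mul_smul, smul_eq_mul (X i), hasse_X_mul, mul_add, mul_left_comm]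
      refine add_mem (Ideal.mul_mem_left _ _ (hp b hb)) ?_
      split_ifs
      -- The derivative has changed to `b - e_i`, hence the quantification over all `b` inside the
      -- induction.
      · exact hp _ ((Finsupp.support_mono tsub_le_self).trans hb)
      · simp
  | mem f hf =>
    obtain ⟨s, hs, rfl⟩ := hf
    intro b hb
    -- The part of `x_s` outside `σ ∪ τ` passes through `∂^(b)`. Its union with `τ` is a non-face:
    -- otherwise it would lie in `st(τ) ⊆ st(σ)`, and adding `σ` would give a face containing `s`.
    have hdisj : Disjoint (s \ (σ ∪ τ)) b.support :=
      Finset.disjoint_of_subset_right hb Finset.sdiff_disjoint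
    rw [← Finset.prod_inter_mul_prod_sdiff s (σ ∪ τ), mul_comm (∏ i ∈ s ∩ _, X i), hasse_prod_X_mul _ _ hdisj, ← mul_assoc,
      ← Finset.prod_union]
    · refine Ideal.mul_mem_right _ _ (prod_X_mem_faceIdeal fun h' => hs ?_)
      have h1 : s \ (σ ∪ τ) ∪ τ ∈ closedStar K τ := by
        have h2 : s \ (σ ∪ τ) ∪ τ ∈ simplices K := by rwa [Finset.union_comm]
        exact ⟨h2, by rwa [Finset.union_assoc, Finset.union_self]⟩
      exact simplices_of_subset (h h1).2 (by
        intro i; simp only [Finset.mem_union, Finset.mem_sdiff]; tauto)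
    · exact Finset.disjoint_sdiff.mono_left Finset.subset_union_right

theorem exists_diffOps_hasse [DecidableEq V] {σ τ : Finset V}
    (h : closedStar K τ ⊆ closedStar K σ) {b : V →₀ ℕ} (hb : b.support ⊆ σ ∪ τ) :
    ∃ ψ : diffOps k (FaceRing k K), ∀ f,
      (ψ : Module.End k (FaceRing k K)) (Ideal.Quotient.mk _ f) =
        Ideal.Quotient.mk _ ((∏ i ∈ τ, X i) * hasse k b f) :=
  exists_diffOps_of_map_le (faceIdeal k K)
    (φ := Algebra.lmul k (MvPolynomial V k) (∏ i ∈ τ, X i) * hasse k b)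
    (mul_mem_diffOpLE b.degree 0 _ (zero_add _) (lmul_mem_diffOpLE_zero _)
      (hasse_mem_diffOpLE _ b le_rfl)) fun _ hf => mul_hasse_mem_faceIdeal h hf b hb

theorem diffOps_sum_apply {k R ι : Type*} [CommRing k] [CommRing R] [Algebra k R] (s : Finset ι)
    (φ : ι → diffOps k R) (x : R) :
    ((∑ i ∈ s, φ i : diffOps k R) : Module.End k R) x = ∑ i ∈ s, (φ i : Module.End k R) x := by
  rw [← Subalgebra.coe_val, map_sum, LinearMap.sum_apply]

theorem diffOps_smul_mul_mul_apply {k R : Type*} [CommRing k] [CommRing R] [Algebra k R]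
    (c : k) (φ ψ : diffOps k R) (r x : R) :
    ((algebraMap k (diffOps k R) c * (φ * diffOpsOfRing k R r * ψ) : diffOps k R) :
      Module.End k R) x = c • (φ : Module.End k R) (r * (ψ : Module.End k R) x) := rfl

theorem diffOpsIdeal_le_of_closedStar_subset [DecidableEq V] {σ τ : Finset V}
    (h : closedStar K τ ⊆ closedStar K σ) :
    diffOpsIdeal k (FaceRing k K) (faceMonomial k K τ) ≤
      diffOpsIdeal k (FaceRing k K) (faceMonomial k K σ) := by
  refine TwoSidedIdeal.span_le.2 (Set.singleton_subset_iff.2 ?_)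
  have hex := fun (b : V →₀ ℕ) (hb : b.support ⊆ σ ∪ τ) =>
    exists_diffOps_hasse (k := k) h hb
  choose! Θ hΘ using hex
  -- `x^a = x_σ x_τ`: the factor `x_σ` is the generator, and `x_τ` is what `∂^(b)` needs in order to
  -- descend.
  let a := sqfreeExp σ + sqfreeExp τ
  have ha : a.support ⊆ σ ∪ τ := by
    intro i; simp [a, sqfreeExp_apply]; tauto
  have hb : ∀ b ∈ Finset.Icc 0 a, b.support ⊆ σ ∪ τ := fun b hb =>
    (Finsupp.support_mono (Finset.mem_Icc.1 hb).2).trans ha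
  have hab : ∀ b : V →₀ ℕ, (a - b).support ⊆ σ ∪ τ := fun b =>
    (Finsupp.support_mono tsub_le_self).trans ha
  have key : diffOpsOfRing k (FaceRing k K) (faceMonomial k K τ) =
      ∑ b ∈ Finset.Icc 0 a, algebraMap k _ ((-1) ^ b.degree) *
        (Θ (a - b) * diffOpsOfRing k (FaceRing k K) (faceMonomial k K σ) * Θ b) := by
    refine Subtype.ext (LinearMap.ext fun x => ?_)
    obtain ⟨f, rfl⟩ := Ideal.Quotient.mk_surjective x
    have ha' : monomial a (1 : k) = (∏ i ∈ σ, X i) * ∏ i ∈ τ, X i := by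
      rw [← monomial_sqfreeExp, ← monomial_sqfreeExp, monomial_mul, one_mul]
    have hterm : ∀ b ∈ Finset.Icc 0 a, (-1 : k) ^ b.degree •
        (Θ (a - b) : Module.End k (FaceRing k K)) (faceMonomial k K σ *
          (Θ b : Module.End k (FaceRing k K)) (Ideal.Quotient.mk _ f)) =
        Ideal.Quotient.mk _ ((∏ i ∈ τ, X i) * ((-1 : k) ^ b.degree •
          hasse k (a - b) (monomial a (1 : k) * hasse k b f))) := by
      intro b hb'
      rw [hΘ b (hb b hb'), faceMonomial, ← map_mul, hΘ _ (hab b), ha',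
        mul_assoc (∏ i ∈ σ, X i), mul_smul_comm]
      rfl
    rw [diffOps_sum_apply]
    simp only [diffOps_smul_mul_mul_apply]
    rw [Finset.sum_congr rfl hterm, ← map_sum, ← Finset.mul_sum, sum_hasse_monomial_mul_hasse,
      map_mul]
    rfl
  rw [SetLike.mem_coe, key]
  refine sum_mem fun b _ => ?_
  exact TwoSidedIdeal.mul_mem_left _ _ _ (TwoSidedIdeal.mul_mem_right _ _ _
    (TwoSidedIdeal.mul_mem_left _ _ _ (TwoSidedIdeal.subset_span rfl)))

end Main

theorem mainTheorem6 {k : Type*} [CommRing k] [IsDomain k] {n : ℕ}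
    (K : PreAbstractSimplicialComplex (Fin n)) (σ τ : Finset (Fin n))
    (hσ : σ ∈ simplices K) (hτ : τ ∈ simplices K) :
    diffOpsIdeal k (FaceRing k K) (faceMonomial k K τ) ≤
        diffOpsIdeal k (FaceRing k K) (faceMonomial k K σ) ↔
      closedStar K τ ⊆ closedStar K σ :=
  ⟨closedStar_subset_of_diffOpsIdeal_le, diffOpsIdeal_le_of_closedStar_subset⟩
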